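/- Let $\Lambda>0$, $k>0$ and $\alpha\in\mathbb{R}$. For $n\in\mathbb{Z}$ put $\alpha_n=\alpha+\frac{2\pi}{\Lambda}n$, let $\beta_n=\sqrt{k^2-\alpha_n^2}$ if $|\alpha_n|\le k$ and $\beta_n=i\sqrt{\alpha_n^2-k^2}$ if $|\alpha_n|>k$, and let $B_\alpha=\{n\in\mathbb{Z}: |\alpha_n|<k\}$, which is a finite set. Assume that $|\alpha_n|\neq k$ for all $n\in\mathbb{Z}$. Let $y=(y_1,y_2)$ and $z=(z_1,z_2)$ be points of $\mathbb{R}^2$ with $|y-z|\neq m\Lambda$ for all $m\in\mathbb{Z}$, where $|\cdot|$ is the Euclidean norm, and put $z_n=(z_1+n\Lambda,z_2)$ for $n\in\mathbb{Z}$. Then $$F^1_\alpha(y,z):=\frac{i}{2\Lambda}\sum_{n\in B_\alpha}\frac{1}{\beta_n}\,e^{i\alpha_n(y_1-z_1)}\cos\big(\beta_n(y_2-z_2)\big)=\sum_{n\in\mathbb{Z}}\frac{i}{4}\,J_0\big(k|y-z_n|\big)\,e^{in\Lambda\alpha},$$ where $J_0(x)=\sum_{m\ge 0}\frac{(-1)^m}{(m!)^2}\left(\frac{x}{2}\right)^{2m}$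 is the Bessel function of the first kind of order zero. The series on the right converges (in general only conditionally), in the sense that its partial sums over $M\le n\le N$ tend to $F^1_\alpha(y,z)$ as $M\to-\infty$ and $N\to\infty$ independently. -/

import Mathlib

open scoped Nat

noncomputable section

namespace QuasiPeriodic

/-- The Bessel function of the first kind of order zero, by its everywhere convergent power series
`J₀(x) = ∑ₘ (-1)ᵐ / (m!)² (x/2)²ᵐ`. -/
def besselJ0 (x : ℝ) : ℝ :=
  ∑' m : ℕ, (-1 : ℝ) ^ m / ((m ! : ℝ) ^ 2) * (x / 2) ^ (2 * m)

/-- The series defining `besselJ0` converges absolutely at every point. -/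
theorem summable_besselJ0 (x : ℝ) :
    Summable fun m : ℕ => (-1 : ℝ) ^ m / ((m ! : ℝ) ^ 2) * (x / 2) ^ (2 * m) := by
  refine Summable.of_norm_bounded (Real.summable_pow_div_factorial ((x / 2) ^ 2)) fun m => ?_
  have h1 : (1 : ℝ) ≤ (m ! : ℝ) := by exact_mod_cast Nat.one_le_iff_ne_zero.2 (Nat.factorial_ne_zero m)
  have h2 : 0 ≤ (x / 2) ^ (2 * m) := by rw [pow_mul]; positivity
  rw [norm_mul, norm_div, norm_pow, norm_neg, norm_one, one_pow, Real.norm_of_nonneg h2,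
    Real.norm_of_nonneg (by positivity), ← pow_mul, div_mul_eq_mul_div, one_mul]
  exact div_le_div_of_nonneg_left h2 (by positivity) (by nlinarith)

/-- `αₙ = α + 2πn/Λ`. -/
def alphaN (Λ α : ℝ) (n : ℤ) : ℝ := α + 2 * Real.pi / Λ * n

/-- `βₙ = √(k² - αₙ²)` if `|αₙ| ≤ k`, and `βₙ = i √(αₙ² - k²)` if `|αₙ| > k`. -/
def betaN (Λ k α : ℝ) (n : ℤ) : ℂ :=
  if |alphaN Λ α n| ≤ k then (Real.sqrt (k ^ 2 - alphaN Λ α n ^ 2) : ℂ)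
  else Complex.I * (Real.sqrt (alphaN Λ α n ^ 2 - k ^ 2) : ℂ)

/-- The index set `B_α` of the propagating modes. -/
def propagating (Λ k α : ℝ) : Set ℤ := {n | |alphaN Λ α n| < k}

/-- There are finitely many propagating modes, so that sums over them are genuine finite sums. -/
theorem finite_propagating {Λ : ℝ} (hΛ : 0 < Λ) (k α : ℝ) : (propagating Λ k α).Finite := by
  have hc : 0 < 2 * Real.pi / Λ := by positivity
  refine (Set.finite_Icc ⌈(-k - α) / (2 * Real.pi / Λ)⌉ ⌊(k - α) / (2 * Real.pi / Λ)⌋).subset ?_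
  intro n hn
  have h := abs_lt.1 (show |α + 2 * Real.pi / Λ * n| < k from hn)
  exact ⟨Int.ceil_le.2 ((div_le_iff₀ hc).2 (by linarith)),
    Int.le_floor.2 ((le_div_iff₀ hc).2 (by linarith))⟩

/-- `F¹_α(y, z) = i/(2Λ) ∑_{n ∈ B_α} βₙ⁻¹ exp(i αₙ (y₁ - z₁)) cos(βₙ (y₂ - z₂))`; the coordinates
`y₁, y₂` of a point of the plane are `y 0, y 1`. -/
def F1 (Λ k α : ℝ) (y z : EuclideanSpace ℝ (Fin 2)) : ℂ :=
  Complex.I / (2 * (Λ : ℂ)) * ∑ᶠ n ∈ propagating Λ k α,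
    1 / betaN Λ k α n * Complex.exp (Complex.I * (alphaN Λ α n : ℂ) * ((y 0 - z 0 : ℝ) : ℂ)) *
      Complex.cos (betaN Λ k α n * ((y 1 - z 1 : ℝ) : ℂ))

/-- The lattice translate `zₙ = (z₁ + nΛ, z₂)`. -/
def latticeShift (Λ : ℝ) (z : EuclideanSpace ℝ (Fin 2)) (n : ℤ) : EuclideanSpace ℝ (Fin 2) :=
  !₂[z 0 + n * Λ, z 1]

end QuasiPeriodic

end

open Filter MeasureTheory Topology intervalIntegral
open scoped Nat

namespace QuasiPeriodic

/-! `J₀(k√(x² + b²))` is `1/π` times the integral over `[-k, k]` of `exp(ixξ) cos(b√(k² - ξ²)) /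
√(k² - ξ²)` (`integral_waveDensity`), so replacing `x` by `x - nΛ` modulates this density by
`exp(-inΛξ)`. The identity is then Poisson summation: summing over `n` samples the density at the
points `αₘ`, and only those with `|αₘ| < k` contribute. The density blows up at `±k`, so absolute
convergence is not available. Instead the line is cut into windows of length `2π/Λ` centred at the
`αₘ`. Finitely many cover `[-k, k]`, and the density is integrable and, since `|αₘ| ≠ k`,
differentiable at each centre. On each window this is pointwise convergence of a Fourier series
(`hasSum_integral_mul_exp`), and `hasSum_besselJ0_mul_exp` adds up the windows. -/

/-! ### Fourier series at a point of differentiability -/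

theorem sum_Icc_int_sub_eq {E : Type*} [AddCommGroup E] (Q : ℤ → E) {M N : ℤ} (h : M ≤ N) :
    ∑ n ∈ Finset.Icc M N, (Q (n + 1) - Q n) = Q (N + 1) - Q M := by
  induction N, h using Int.leInduction with
  | base => simp
  | succ n hn ih =>
    have : Finset.Icc M (n + 1) = insert (n + 1) (Finset.Icc M n) := by
      ext x; simp only [Finset.mem_insert, Finset.mem_Icc]; omega
    rw [this, Finset.sum_insert (by simp), ih]
    abel

theorem hasSum_conditional_telescope {E : Type*} [AddCommGroup E] [TopologicalSpace E]
    [IsTopologicalAddGroup E] {Q : ℤ → E} (htop : Tendsto Q atTop (𝓝 0))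
    (hbot : Tendsto Q atBot (𝓝 0)) :
    HasSum (fun n : ℤ => Q (n + 1) - Q n) 0 (SummationFilter.conditional ℤ) := by
  rw [HasSum, SummationFilter.conditional_filter, tendsto_map'_iff]
  have h1 : Tendsto (fun p : ℤ × ℤ => Q (p.2 + 1) - Q p.1) (atBot ×ˢ atTop) (𝓝 0) := by
    simpa using ((htop.comp (tendsto_atTop_add_const_right atTop 1 tendsto_id)).comp
      tendsto_snd).sub (hbot.comp tendsto_fst)
  refine h1.congr' ?_
  filter_upwards [(eventually_le_atBot (0 : ℤ)).prod_mk (eventually_ge_atTop (0 : ℤ))] with p hp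
  exact (sum_Icc_int_sub_eq Q (hp.1.trans hp.2)).symm

/-- Riemann–Lebesgue, sampled at the frequencies `n/(2π)`, which leave every compact set. -/
theorem tendsto_intervalIntegral_mul_exp {a b : ℝ} (hab : a ≤ b) (q : ℝ → ℂ) :
    Tendsto (fun n : ℤ => ∫ u in a..b, q u * Complex.exp (-(Complex.I * n * u)))
      cofinite (𝓝 0) := by
  have h := Real.tendsto_integral_exp_smul_cocompact ((Set.Ioc a b).indicator q)
  have h2 : Tendsto (fun n : ℤ => (n : ℝ) * (2 * Real.pi)⁻¹) cofinite (cocompact ℝ) :=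
    (Homeomorph.mulRight₀ (2 * Real.pi)⁻¹ (by positivity)).isClosedEmbedding.tendsto_cocompact.comp
      Int.tendsto_coe_cofinite
  refine (h.comp h2).congr fun n => ?_
  rw [integral_of_le hab, ← MeasureTheory.integral_indicator measurableSet_Ioc]
  refine integral_congr_ae (.of_forall fun u => ?_)
  by_cases hu : u ∈ Set.Ioc a b
  · simp only [Set.indicator_of_mem hu, Circle.smul_def, Real.fourierChar_apply, smul_eq_mul]
    rw [mul_comm]
    congr 2
    push_cast
    have : (Real.pi : ℂ) ≠ 0 := by exact_mod_cast Real.pi_ne_zero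
    field_simp
  · simp [Set.indicator_of_notMem hu]

theorem two_div_pi_mul_abs_le_norm_exp_sub_one {u : ℝ} (hu : |u| ≤ Real.pi) :
    2 / Real.pi * |u| ≤ ‖Complex.exp (-(Complex.I * u)) - 1‖ := by
  have h := Complex.norm_exp_I_mul_ofReal_sub_one (-u)
  have h2 := Real.mul_abs_le_abs_sin (x := -u / 2) (by rw [abs_div, abs_neg, abs_two]; linarith)
  rw [abs_div, abs_neg, abs_two] at h2
  push_cast at h
  rw [← mul_neg, h, norm_mul, Real.norm_eq_abs, Real.norm_eq_abs, abs_two]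
  linarith

/-- Differentiability at `0` makes the numerator `O(u)`, while the denominator is at least `2|u|/π`.
-/
theorem intervalIntegrable_sub_div_exp_sub_one {G : ℝ → ℂ}
    (hG : IntervalIntegrable G volume (-Real.pi) Real.pi) (hd : DifferentiableAt ℝ G 0) :
    IntervalIntegrable (fun u : ℝ => (G u - G 0) / (Complex.exp (-(Complex.I * u)) - 1)) volume
      (-Real.pi) Real.pi := by
  have hsub : IntervalIntegrable (fun u => G u - G 0) volume (-Real.pi) Real.pi :=
    hG.sub intervalIntegrable_const
  obtain ⟨C, hC⟩ := (hd.hasDerivAt.isBigO_sub).bound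
  obtain ⟨δ, hδ, hball⟩ := Metric.eventually_nhds_iff.1 hC
  -- The bounds for `|u| < δ` and `|u| ≥ δ` are added, giving one integrable factor valid
  -- everywhere.
  have hbound : ∀ u : ℝ, ‖G u - G 0‖ ≤ (|C| + ‖G u - G 0‖ / δ) * |u| := fun u => by
    rcases lt_or_ge |u| δ with h | h
    · have h1 := hball (y := u) (by simpa using h)
      simp only [sub_zero, Real.norm_eq_abs] at h1
      calc _ ≤ C * |u| := h1
        _ ≤ (|C| + ‖G u - G 0‖ / δ) * |u| := by
          gcongr
          exact (le_abs_self C).trans (le_add_of_nonneg_right (by positivity))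
    · calc ‖G u - G 0‖ = ‖G u - G 0‖ / δ * δ := by field_simp
        _ ≤ (|C| + ‖G u - G 0‖ / δ) * |u| := by
          gcongr
          exact le_add_of_nonneg_left (by positivity)
  have hdom : IntervalIntegrable (fun u => Real.pi / 2 * (|C| + ‖G u - G 0‖ / δ)) volume
      (-Real.pi) Real.pi := (intervalIntegrable_const.add (hsub.norm.div_const δ)).const_mul _
  have hpi := Real.pi_pos
  refine hdom.mono_fun' ?_ ?_
  · exact (hsub.aestronglyMeasurable_restrict_uIoc.aemeasurable.div
      (by fun_prop : Measurable fun u : ℝ =>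
        Complex.exp (-(Complex.I * u)) - 1).aemeasurable).aestronglyMeasurable
  · refine (ae_restrict_mem measurableSet_uIoc).mono fun u hu => ?_
    rw [Set.uIoc_of_le (by linarith)] at hu
    have hlow := two_div_pi_mul_abs_le_norm_exp_sub_one (abs_le.2 ⟨hu.1.le, hu.2⟩)
    rcases eq_or_ne u 0 with rfl | hu0
    · simp only [sub_self, zero_div, norm_zero]; positivity
    have hu' : 0 < |u| := abs_pos.2 hu0
    have hA : 0 ≤ |C| + ‖G u - G 0‖ / δ := by positivity
    simp only [norm_div]
    rw [div_le_iff₀ (lt_of_lt_of_le (by positivity) hlow)]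
    calc _ ≤ _ := hbound u
      _ = Real.pi / 2 * (|C| + ‖G u - G 0‖ / δ) * (2 / Real.pi * |u|) := by field_simp
      _ ≤ _ := by gcongr

theorem integral_exp_neg_int (n : ℤ) :
    ∫ u in -Real.pi..Real.pi, Complex.exp (-(Complex.I * n * u)) =
      if n = 0 then 2 * (Real.pi : ℂ) else 0 := by
  split_ifs with h
  · subst h
    simp
    ring
  · have hc : -(Complex.I * n) ≠ 0 := by simpa using h
    have := integral_exp_mul_complex (a := -Real.pi) (b := Real.pi) hc
    simp only [neg_mul] at this
    rw [this]
    have : Complex.exp (-(Complex.I * n * Real.pi)) =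
        Complex.exp (-(Complex.I * n * ((-Real.pi : ℝ) : ℂ))) :=
      Complex.exp_eq_exp_iff_exists_int.2 ⟨-n, by push_cast; ring⟩
    rw [this, sub_self, zero_div]

/-- Pointwise convergence of the Fourier series at a point of differentiability, with the two ends
of the partial sums going to infinity independently. -/
theorem hasSum_integral_mul_exp {G : ℝ → ℂ}
    (hG : IntervalIntegrable G volume (-Real.pi) Real.pi) (hd : DifferentiableAt ℝ G 0) :
    HasSum (fun n : ℤ => ∫ u in -Real.pi..Real.pi, G u * Complex.exp (-(Complex.I * n * u)))
      (2 * Real.pi * G 0) (SummationFilter.conditional ℤ) := by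
  -- Multiplication by `exp(-iu) - 1` acts on Fourier coefficients as a forward difference, so those
  -- of `G - G 0` telescope and Riemann–Lebesgue kills both ends.
  set q : ℝ → ℂ := fun u => (G u - G 0) / (Complex.exp (-(Complex.I * u)) - 1) with hq
  have hqi : IntervalIntegrable q volume (-Real.pi) Real.pi :=
    intervalIntegrable_sub_div_exp_sub_one hG hd
  set Q : ℤ → ℂ :=
    fun n => ∫ u in -Real.pi..Real.pi, q u * Complex.exp (-(Complex.I * n * u)) with hQ
  have hpi := Real.pi_pos
  have hle : -Real.pi ≤ Real.pi := by linarith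
  have hlim : Tendsto Q cofinite (𝓝 0) := tendsto_intervalIntegral_mul_exp hle q
  rw [Int.cofinite_eq, tendsto_sup] at hlim
  have hcont : ∀ n : ℤ, Continuous fun u : ℝ => Complex.exp (-(Complex.I * n * u)) :=
    fun n => by fun_prop
  have hterm : ∀ n : ℤ, ∫ u in -Real.pi..Real.pi, G u * Complex.exp (-(Complex.I * n * u)) =
      (Q (n + 1) - Q n) + if n = 0 then 2 * Real.pi * G 0 else 0 := fun n => by
    have hqe : ∀ m : ℤ, IntervalIntegrable (fun u : ℝ => q u * Complex.exp (-(Complex.I * m * u)))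
        volume (-Real.pi) Real.pi := fun m => hqi.mul_continuousOn (hcont m).continuousOn
    have hconst : (∫ u in -Real.pi..Real.pi, G 0 * Complex.exp (-(Complex.I * n * u))) =
        if n = 0 then 2 * Real.pi * G 0 else 0 := by
      rw [intervalIntegral.integral_const_mul, integral_exp_neg_int]
      split_ifs <;> ring
    rw [← hconst, hQ, ← integral_sub (hqe _) (hqe _), ← integral_add ((hqe _).sub (hqe _))
      (((hcont n).intervalIntegrable _ _).const_mul _)]
    refine integral_congr fun u hu => ?_
    rw [Set.uIcc_of_le hle] at hu
    have hexp : Complex.exp (-(Complex.I * ((n + 1 : ℤ) : ℂ) * u)) =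
        Complex.exp (-(Complex.I * n * u)) * Complex.exp (-(Complex.I * u)) := by
      rw [← Complex.exp_add]; push_cast; ring_nf
    have hqu : q u * (Complex.exp (-(Complex.I * u)) - 1) = G u - G 0 := by
      rcases eq_or_ne u 0 with rfl | hu0
      · simp
      · have hlow := two_div_pi_mul_abs_le_norm_exp_sub_one (abs_le.2 hu)
        have hu' : 0 < |u| := abs_pos.2 hu0
        exact div_mul_cancel₀ _ (norm_pos_iff.1 (lt_of_lt_of_le (by positivity) hlow))
    simp only [hexp]
    linear_combination (-Complex.exp (-(Complex.I * n * u))) * hqu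
  simp_rw [hterm]
  simpa using (hasSum_conditional_telescope hlim.2 hlim.1).add
    (hasSum_ite_eq (L := SummationFilter.conditional ℤ) (0 : ℤ) (2 * Real.pi * G 0))

/-- The same convergence for a function on a window of length `2π/Λ` centred at `a`. -/
theorem hasSum_integral_window {Λ : ℝ} (hΛ : 0 < Λ) {a : ℝ} {g : ℝ → ℂ}
    (hg : IntervalIntegrable g volume (a - Real.pi / Λ) (a + Real.pi / Λ))
    (hd : DifferentiableAt ℝ g a) :
    HasSum (fun n : ℤ => ∫ ξ in (a - Real.pi / Λ)..(a + Real.pi / Λ),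
      g ξ * Complex.exp (Complex.I * n * Λ * (a - ξ)))
      (2 * Real.pi / Λ * g a) (SummationFilter.conditional ℤ) := by
  have hΛ' : (Λ : ℂ) ≠ 0 := by exact_mod_cast hΛ.ne'
  have hG : IntervalIntegrable (fun u => g (a + u / Λ)) volume (-Real.pi) Real.pi := by
    have h1 := (hg.comp_add_left a).comp_mul_left (c := Λ⁻¹)
    convert h1 using 1
    · ext u; congr 1; ring
    · field_simp; ring
    · field_simp; ring
  have hdG : DifferentiableAt ℝ (fun u => g (a + u / Λ)) 0 := by
    have : DifferentiableAt ℝ g (a + 0 / Λ) := by simpa using hd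
    exact this.comp (0 : ℝ) (f := fun u : ℝ => a + u / Λ) (by fun_prop)
  have h := (hasSum_integral_mul_exp hG hdG).mul_left ((Λ : ℂ)⁻¹)
  have hval : (Λ : ℂ)⁻¹ * (2 * Real.pi * g (a + 0 / Λ)) = 2 * Real.pi / Λ * g a := by
    rw [zero_div, add_zero]; ring
  rw [hval] at h
  refine h.congr_fun fun n => ?_
  have h2 := integral_comp_add_div (a := -Real.pi) (b := Real.pi) (c := Λ)
    (fun ξ : ℝ => g ξ * Complex.exp (Complex.I * n * Λ * (a - ξ))) hΛ.ne' a
  rw [show a - Real.pi / Λ = a + -Real.pi / Λ by ring, eq_inv_mul_iff_mul_eq₀ hΛ',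
    ← Complex.real_smul, ← h2]
  refine integral_congr fun u _ => ?_
  congr 2
  push_cast
  field_simp
  ring

/-! ### Integral representations of `J₀` -/

theorem prod_range_wallis (m : ℕ) :
    ∏ i ∈ Finset.range m, (2 * (i : ℝ) + 1) / (2 * i + 2) =
      ((2 * m)! : ℝ) / (4 ^ m * (m ! : ℝ) ^ 2) := by
  induction m with
  | zero => simp
  | succ m ih =>
    rw [Finset.prod_range_succ, ih, show 2 * (m + 1) = 2 * m + 1 + 1 by ring, Nat.factorial_succ,
      Nat.factorial_succ, Nat.factorial_succ]
    push_cast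
    field_simp
    ring

/-- The cosine series is integrated termwise; the `(2m)!` of the Wallis integral cancels that of the
cosine coefficient. The series of `cosh r` dominates. -/
theorem integral_cos_mul_sin (r : ℝ) :
    ∫ θ in 0..Real.pi, Real.cos (r * Real.sin θ) = Real.pi * besselJ0 r := by
  set F : ℕ → C(ℝ, ℝ) := fun m =>
    ⟨fun θ => (-1) ^ m * (r * Real.sin θ) ^ (2 * m) / (2 * m)!, by fun_prop⟩ with hF
  have hsum : Summable fun m : ℕ =>
      ‖(F m).restrict (⟨Set.uIcc 0 Real.pi, isCompact_uIcc⟩ : TopologicalSpace.Compacts ℝ)‖ := by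
    refine Summable.of_nonneg_of_le (fun _ => norm_nonneg _) (fun m => ?_)
      (Real.hasSum_cosh r).summable
    refine (ContinuousMap.norm_le _ (by rw [pow_mul]; positivity)).2 fun θ => ?_
    have h1 : (r * Real.sin θ) ^ (2 * m) ≤ r ^ (2 * m) := by
      rw [mul_pow, pow_mul (Real.sin θ)]
      refine mul_le_of_le_one_right (by rw [pow_mul]; positivity)
        (pow_le_one₀ (sq_nonneg _) (Real.sin_sq_le_one _))
    have h0 : 0 ≤ (r * Real.sin θ) ^ (2 * m) := by rw [pow_mul]; positivity
    simp only [hF, ContinuousMap.restrict_apply, ContinuousMap.coe_mk, norm_div, norm_mul, norm_pow,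
      norm_neg, norm_one, one_pow, one_mul]
    rw [← norm_mul, ← norm_pow, Real.norm_of_nonneg h0, Real.norm_natCast]
    gcongr
  have h := hasSum_intervalIntegral_of_summable_norm hsum
  have hcos : ∀ θ : ℝ, ∑' m, F m θ = Real.cos (r * Real.sin θ) := fun θ =>
    (Real.hasSum_cos _).tsum_eq
  simp_rw [hcos] at h
  refine h.unique ?_
  have hJ := ((summable_besselJ0 r).hasSum).mul_left Real.pi
  refine hJ.congr_fun fun m => ?_
  have hI : ∀ θ : ℝ, F m θ = ((-1) ^ m * r ^ (2 * m) / (2 * m)!) * Real.sin θ ^ (2 * m) :=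
    fun θ => by simp only [hF, ContinuousMap.coe_mk, mul_pow]; ring
  simp_rw [hI]
  rw [intervalIntegral.integral_const_mul, integral_sin_pow_even, prod_range_wallis,
    div_pow, pow_mul 2]
  norm_num
  field_simp

theorem integral_exp_mul_sin (r : ℝ) :
    ∫ θ in -Real.pi..Real.pi, Complex.exp (Complex.I * r * Real.sin θ) =
      2 * Real.pi * besselJ0 r := by
  have hc : Continuous fun θ : ℝ => Complex.exp (Complex.I * r * Real.sin θ) := by fun_prop
  rw [← integral_add_adjacent_intervals (hc.intervalIntegrable (-Real.pi) 0)
    (hc.intervalIntegrable 0 Real.pi)]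
  have h1 : ∫ θ in -Real.pi..0, Complex.exp (Complex.I * r * Real.sin θ) =
      ∫ θ in 0..Real.pi, Complex.exp (-(Complex.I * r * Real.sin θ)) := by
    have := integral_comp_neg (a := 0) (b := Real.pi)
      (fun θ : ℝ => Complex.exp (Complex.I * r * Real.sin θ))
    simpa using this.symm
  rw [h1, ← integral_add (Continuous.intervalIntegrable (by fun_prop) _ _)
    (hc.intervalIntegrable 0 Real.pi), mul_assoc, ← Complex.ofReal_mul, ← integral_cos_mul_sin,
    ← intervalIntegral.integral_ofReal, ← intervalIntegral.integral_const_mul]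
  refine integral_congr fun θ _ => ?_
  simp only [Complex.ofReal_cos, Complex.cos]
  push_cast
  ring_nf

/-- The average of a plane wave over directions, for the wave vector `k (cos θ, sin θ)`. -/
theorem integral_planeWave (x b k : ℝ) :
    ∫ θ in -Real.pi..Real.pi,
      Complex.exp (Complex.I * k * (x * Real.cos θ + b * Real.sin θ : ℝ)) =
      2 * Real.pi * besselJ0 (k * Real.sqrt (x ^ 2 + b ^ 2)) := by
  -- With `w = b + ix`, `x cos θ + b sin θ = ‖w‖ sin(θ + arg w)`, and periodicity absorbs the phase.
  set w : ℂ := ⟨b, x⟩ with hw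
  have hn : Real.sqrt (x ^ 2 + b ^ 2) = ‖w‖ := by
    rw [Complex.norm_def, Complex.normSq_mk]; congr 1; ring
  have hb : ‖w‖ * Real.cos w.arg = b := Complex.norm_mul_cos_arg w
  have hx : ‖w‖ * Real.sin w.arg = x := Complex.norm_mul_sin_arg w
  rw [hn, ← integral_exp_mul_sin]
  have hp : Function.Periodic
      (fun θ : ℝ => Complex.exp (Complex.I * (k * ‖w‖ : ℝ) * Real.sin θ)) (2 * Real.pi) :=
    fun θ => by simp only [Real.sin_add_two_pi]
  have h1 := hp.intervalIntegral_add_eq (-Real.pi) (-Real.pi + w.arg)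
  rw [show -Real.pi + 2 * Real.pi = Real.pi by ring,
    show -Real.pi + w.arg + 2 * Real.pi = Real.pi + w.arg by ring] at h1
  rw [h1, ← integral_comp_add_right (fun θ : ℝ =>
    Complex.exp (Complex.I * (k * ‖w‖ : ℝ) * Real.sin θ)) w.arg]
  refine integral_congr fun θ _ => ?_
  rw [mul_assoc, mul_assoc, ← Complex.ofReal_mul, ← Complex.ofReal_mul, Real.sin_add,
    show k * ‖w‖ * (Real.sin θ * Real.cos w.arg + Real.cos θ * Real.sin w.arg) =
      k * ((‖w‖ * Real.sin w.arg) * Real.cos θ + (‖w‖ * Real.cos w.arg) * Real.sin θ) by ring,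
    hb, hx]

/-- Folding the plane wave average by `θ ↦ -θ` flips only the sine term, which becomes a cosine
factor. -/
theorem integral_exp_cos_mul_cos_sin (x b k : ℝ) :
    ∫ θ in 0..Real.pi, Complex.exp (Complex.I * x * (k * Real.cos θ : ℝ)) *
      Complex.cos ((b * (k * Real.sin θ) : ℝ)) =
      Real.pi * besselJ0 (k * Real.sqrt (x ^ 2 + b ^ 2)) := by
  have hc : Continuous fun θ : ℝ =>
      Complex.exp (Complex.I * k * (x * Real.cos θ + b * Real.sin θ : ℝ)) := by fun_prop
  have h := integral_planeWave x b k
  rw [← integral_add_adjacent_intervals (hc.intervalIntegrable (-Real.pi) 0)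
    (hc.intervalIntegrable 0 Real.pi)] at h
  have h1 := integral_comp_neg (a := 0) (b := Real.pi)
      (fun θ : ℝ => Complex.exp (Complex.I * k * (x * Real.cos θ + b * Real.sin θ : ℝ)))
  rw [neg_zero] at h1
  rw [← h1, ← integral_add (Continuous.intervalIntegrable (by fun_prop) _ _)
    (hc.intervalIntegrable 0 Real.pi)] at h
  refine mul_left_cancel₀ (two_ne_zero (α := ℂ)) ?_
  rw [← mul_assoc, ← h, ← intervalIntegral.integral_const_mul]
  refine integral_congr fun θ _ => ?_
  simp only [Complex.cos, Real.cos_neg, Real.sin_neg]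
  rw [mul_div_assoc', mul_div_assoc', div_eq_iff two_ne_zero,
    show ∀ a b c : ℂ, 2 * (a * (b + c)) = (a * c + a * b) * 2 from fun a b c => by ring,
    ← Complex.exp_add, ← Complex.exp_add]
  push_cast
  ring_nf

/-! ### The plane wave density -/

/-- The density of `J₀(k √(x² + b²))` over its plane wave spectrum; it vanishes for `k ≤ |ξ|`. -/
noncomputable def waveDensity (k x b ξ : ℝ) : ℂ :=
  Complex.exp (Complex.I * x * ξ) * Complex.cos ((b * Real.sqrt (k ^ 2 - ξ ^ 2) : ℝ)) /
    (Real.sqrt (k ^ 2 - ξ ^ 2) : ℝ)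

theorem waveDensity_sub (k x c b ξ : ℝ) :
    waveDensity k (x - c) b ξ = waveDensity k x b ξ * Complex.exp (-(Complex.I * c * ξ)) := by
  rw [waveDensity, waveDensity, show Complex.I * ((x - c : ℝ) : ℂ) * ξ =
    Complex.I * x * ξ + -(Complex.I * c * ξ) by push_cast; ring, Complex.exp_add]
  ring

/-- The real square root vanishes here and division by zero gives zero, so no explicit cutoff is
needed. -/
theorem waveDensity_eq_zero {k x b ξ : ℝ} (hk : 0 ≤ k) (h : k ≤ |ξ|) :
    waveDensity k x b ξ = 0 := by
  have : k ^ 2 - ξ ^ 2 ≤ 0 := by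
    rw [← sq_abs ξ]; nlinarith
  simp [waveDensity, Real.sqrt_eq_zero_of_nonpos this]

theorem differentiableAt_waveDensity {k x b ξ : ℝ} (hk : 0 ≤ k) (h : |ξ| ≠ k) :
    DifferentiableAt ℝ (waveDensity k x b) ξ := by
  rcases lt_or_gt_of_ne h with h | h
  · have hpos : 0 < k ^ 2 - ξ ^ 2 := by
      have := sq_lt_sq' (by linarith [abs_nonneg ξ]) h
      rw [sq_abs] at this; linarith
    have hs : DifferentiableAt ℝ (fun ξ => Real.sqrt (k ^ 2 - ξ ^ 2)) ξ :=
      DifferentiableAt.sqrt (by fun_prop) hpos.ne'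
    have hs1 : DifferentiableAt ℝ (fun ξ => ((Real.sqrt (k ^ 2 - ξ ^ 2) : ℝ) : ℂ)) ξ :=
      Complex.ofRealCLM.differentiableAt.comp ξ hs
    have hs2 : DifferentiableAt ℝ (fun ξ : ℝ => (ξ : ℂ)) ξ := Complex.ofRealCLM.differentiableAt
    have hne : ((Real.sqrt (k ^ 2 - ξ ^ 2) : ℝ) : ℂ) ≠ 0 := by
      exact_mod_cast (Real.sqrt_pos.2 hpos).ne'
    unfold waveDensity
    simp only [Complex.ofReal_mul]
    exact ((hs2.const_mul _).cexp.mul ((Complex.differentiable_cos.restrictScalars ℝ _).comp ξ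
      (hs1.const_mul _))).fun_div hs1 hne
  · refine (differentiableAt_const (0 : ℂ)).congr_of_eventuallyEq ?_
    filter_upwards [continuous_abs.continuousAt.eventually (lt_mem_nhds h)] with η hη
    exact waveDensity_eq_zero hk (le_of_lt hη)

/-- Under `ξ = k cos θ` the Jacobian cancels the singular denominator, leaving a continuous
integrand. -/
theorem neg_deriv_smul_waveDensity {k : ℝ} (hk : 0 < k) (x b : ℝ) {θ : ℝ}
    (hθ : θ ∈ Set.Ioo 0 Real.pi) :
    (-(k * Real.sin θ)) • waveDensity k x b (k * Real.cos θ) =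
      -(Complex.exp (Complex.I * x * (k * Real.cos θ : ℝ)) *
        Complex.cos ((b * (k * Real.sin θ) : ℝ))) := by
  have hs : 0 < k * Real.sin θ := mul_pos hk (Real.sin_pos_of_mem_Ioo hθ)
  have hsq : Real.sqrt (k ^ 2 - (k * Real.cos θ) ^ 2) = k * Real.sin θ := by
    rw [← Real.sqrt_sq hs.le]
    congr 1
    linear_combination (-k ^ 2) * Real.sin_sq_add_cos_sq θ
  have hne : ((k * Real.sin θ : ℝ) : ℂ) ≠ 0 := by exact_mod_cast hs.ne'
  rw [waveDensity, hsq, Complex.real_smul, Complex.ofReal_neg, neg_mul,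
    mul_div_cancel₀ _ hne]

theorem hasDerivAt_const_mul_cos (k θ : ℝ) :
    HasDerivAt (fun θ => k * Real.cos θ) (-(k * Real.sin θ)) θ := by
  simpa using (Real.hasDerivAt_cos θ).const_mul k

theorem integrableOn_waveDensity {k : ℝ} (hk : 0 < k) (x b : ℝ) :
    IntegrableOn (waveDensity k x b) (Set.Icc (-k) k) := by
  have h := integrableOn_Icc_deriv_smul_iff_of_deriv_nonpos (f := fun θ => k * Real.cos θ)
    (f' := fun θ => -(k * Real.sin θ)) (g := waveDensity k x b) (a := 0) (b := Real.pi)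
    (by fun_prop) (fun θ _ => hasDerivAt_const_mul_cos k θ)
    (fun θ hθ => neg_nonpos.2 (mul_pos hk (Real.sin_pos_of_mem_Ioo hθ)).le) Real.pi_pos.le
  simp only [Real.cos_pi, Real.cos_zero, mul_neg, mul_one] at h
  rw [← h, integrableOn_Icc_iff_integrableOn_Ioo]
  refine IntegrableOn.congr_fun ?_ (fun θ hθ => (neg_deriv_smul_waveDensity hk x b hθ).symm)
    measurableSet_Ioo
  exact ((Continuous.integrableOn_Icc (by fun_prop)).mono_set Set.Ioo_subset_Icc_self)

theorem integral_waveDensity {k : ℝ} (hk : 0 < k) (x b : ℝ) :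
    ∫ ξ in Set.Icc (-k) k, waveDensity k x b ξ =
      Real.pi * besselJ0 (k * Real.sqrt (x ^ 2 + b ^ 2)) := by
  have h := integral_Icc_deriv_smul_of_deriv_nonpos (f := fun θ => k * Real.cos θ)
    (f' := fun θ => -(k * Real.sin θ)) (g := waveDensity k x b) (a := 0) (b := Real.pi)
    (by fun_prop) (fun θ _ => hasDerivAt_const_mul_cos k θ)
    (fun θ hθ => neg_nonpos.2 (mul_pos hk (Real.sin_pos_of_mem_Ioo hθ)).le) Real.pi_pos.le
  simp only [Real.cos_pi, Real.cos_zero, mul_neg, mul_one] at h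
  rw [← neg_inj, ← h, ← integral_exp_cos_mul_cos_sin, integral_of_le Real.pi_pos.le,
    integral_Ioc_eq_integral_Ioo, integral_Icc_eq_integral_Ioo, ← MeasureTheory.integral_neg]
  exact setIntegral_congr_fun measurableSet_Ioo fun θ hθ => neg_deriv_smul_waveDensity hk x b hθ

theorem integrable_waveDensity {k : ℝ} (hk : 0 < k) (x b : ℝ) :
    Integrable (waveDensity k x b) := by
  rw [← integrableOn_univ]
  refine (integrableOn_waveDensity hk x b).of_forall_sdiff_eq_zero MeasurableSet.univ fun ξ hξ => ?_
  refine waveDensity_eq_zero hk.le (not_lt.1 fun h => hξ.2 (abs_le.1 h.le))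

/-! ### Windows and Poisson summation -/

theorem norm_sub_latticeShift (Λ : ℝ) (y z : EuclideanSpace ℝ (Fin 2)) (n : ℤ) :
    ‖y - latticeShift Λ z n‖ = Real.sqrt ((y 0 - z 0 - n * Λ) ^ 2 + (y 1 - z 1) ^ 2) := by
  simp [EuclideanSpace.norm_eq, Fin.sum_univ_two, latticeShift, sub_sub]

/-- Since `Λ(αₘ - α) = 2πm`, the phase does not depend on the window, which lets the window
integrals be glued. -/
theorem exp_mul_alphaN_sub {Λ : ℝ} (hΛ : 0 < Λ) (α ξ : ℝ) (m n : ℤ) :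
    Complex.exp (Complex.I * n * Λ * (alphaN Λ α m - ξ)) =
      Complex.exp (Complex.I * n * Λ * α) * Complex.exp (-(Complex.I * (n * Λ : ℝ) * ξ)) := by
  have hΛ' : (Λ : ℂ) ≠ 0 := by exact_mod_cast hΛ.ne'
  rw [← Complex.exp_add]
  refine Complex.exp_eq_exp_iff_exists_int.2 ⟨n * m, ?_⟩
  simp only [alphaN]
  push_cast
  field_simp
  ring

/-- As `α_K - π/Λ = α_{K-1} + π/Λ`, the `2K` windows centred at `α_{-K}, …, α_{K-1}` cover `[-k,
k]`. -/
theorem exists_nat_window_cover {Λ : ℝ} (hΛ : 0 < Λ) (k α : ℝ) :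
    ∃ K : ℕ, alphaN Λ α (-K) - Real.pi / Λ ≤ -k ∧ k ≤ alphaN Λ α K - Real.pi / Λ := by
  obtain ⟨K, hK⟩ := exists_nat_ge ((|k| + |α| + Real.pi / Λ) / (2 * Real.pi / Λ))
  have hpi := Real.pi_pos
  have hpos : 0 < Real.pi / Λ := by positivity
  rw [div_le_iff₀ (by positivity)] at hK
  refine ⟨K, ?_, ?_⟩ <;> simp only [alphaN] <;> push_cast <;>
    linarith [le_abs_self k, neg_abs_le k, le_abs_self α, neg_abs_le α]

theorem intervalIntegral_waveDensity {k : ℝ} (hk : 0 < k) (x b : ℝ) {p q : ℝ} (hp : p ≤ -k)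
    (hq : k ≤ q) :
    ∫ ξ in p..q, waveDensity k x b ξ =
      Real.pi * besselJ0 (k * Real.sqrt (x ^ 2 + b ^ 2)) := by
  rw [← integral_waveDensity hk, integral_of_le (by linarith),
    setIntegral_eq_integral_of_forall_compl_eq_zero fun ξ hξ => ?_,
    setIntegral_eq_integral_of_forall_compl_eq_zero fun ξ hξ => ?_]
  · exact waveDensity_eq_zero hk.le (not_lt.1 fun h => hξ (abs_le.1 h.le))
  · refine waveDensity_eq_zero hk.le (not_lt.1 fun h => hξ ?_)
    obtain ⟨h1, h2⟩ := abs_lt.1 h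
    exact ⟨by linarith, by linarith⟩

theorem finsum_propagating_eq_sum {Λ k α : ℝ} (hΛ : 0 < Λ) (hk : 0 < k) (x b : ℝ) {K : ℕ}
    (hK : alphaN Λ α (-K) - Real.pi / Λ ≤ -k) (hK' : k ≤ alphaN Λ α K - Real.pi / Λ) :
    ∑ᶠ n ∈ propagating Λ k α,
      1 / betaN Λ k α n * Complex.exp (Complex.I * (alphaN Λ α n : ℂ) * (x : ℂ)) *
        Complex.cos (betaN Λ k α n * (b : ℂ)) =
      ∑ j ∈ Finset.range (2 * K), waveDensity k x b (alphaN Λ α ((j : ℤ) - K)) := by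
  have hinj : Set.InjOn (fun j : ℕ => (j : ℤ) - K) (Finset.range (2 * K)) :=
    fun i _ j _ h => by simpa using h
  rw [← Finset.sum_image (f := fun m : ℤ => waveDensity k x b (alphaN Λ α m)) hinj,
    ← finsum_mem_eq_sum_of_inter_support_eq (s := propagating Λ k α)]
  · refine finsum_mem_congr rfl fun n hn => ?_
    have hn' : |alphaN Λ α n| ≤ k := le_of_lt hn
    rw [betaN, if_pos hn', waveDensity]
    push_cast
    ring_nf
  · ext m
    simp only [Set.mem_inter_iff, Function.mem_support, and_congr_left_iff]
    intro hm
    have hlt : |alphaN Λ α m| < k := not_le.1 fun h => hm (waveDensity_eq_zero hk.le h)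
    refine ⟨fun _ => ?_, fun _ => hlt⟩
    obtain ⟨h1, h2⟩ := abs_lt.1 hlt
    have hpi := Real.pi_pos
    have hpos : 0 < Real.pi / Λ := by positivity
    simp only [alphaN] at hK hK' h1 h2
    rw [mul_div_assoc] at hK hK' h1 h2
    push_cast at hK hK'
    -- The cover gives `-K - 1/2 < m < K - 1/2`; integrality rounds this to `-K ≤ m < K`.
    have hlo : (-(K : ℤ)) < m + 1 := by
      have : (-(K : ℝ)) < m + 1 := by
        by_contra! hcon
        have := mul_le_mul_of_nonneg_left hcon hpos.le
        linarith
      exact_mod_cast this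
    have hhi : m < (K : ℤ) := by
      have : (m : ℝ) < K := by
        by_contra! hcon
        have := mul_le_mul_of_nonneg_left hcon hpos.le
        linarith
      exact_mod_cast this
    simp only [Finset.coe_image, Set.mem_image, Finset.mem_coe, Finset.mem_range]
    exact ⟨(m + K).toNat, by omega, by omega⟩

/-- Poisson summation for the plane wave spectrum of `J₀(k √(x² + b²))`. -/
theorem hasSum_besselJ0_mul_exp {Λ k α : ℝ} (hΛ : 0 < Λ) (hk : 0 < k)
    (hWood : ∀ n : ℤ, |alphaN Λ α n| ≠ k) (x b : ℝ) :
    HasSum (fun n : ℤ => (besselJ0 (k * Real.sqrt ((x - n * Λ) ^ 2 + b ^ 2)) : ℂ) *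
        Complex.exp (Complex.I * n * Λ * α))
      (2 / Λ * ∑ᶠ n ∈ propagating Λ k α,
        1 / betaN Λ k α n * Complex.exp (Complex.I * (alphaN Λ α n : ℂ) * (x : ℂ)) *
          Complex.cos (betaN Λ k α n * (b : ℂ))) (SummationFilter.conditional ℤ) := by
  obtain ⟨K, hK, hK'⟩ := exists_nat_window_cover hΛ k α
  have hΛ' : (Λ : ℂ) ≠ 0 := by exact_mod_cast hΛ.ne'
  have hpi : (Real.pi : ℂ) ≠ 0 := by exact_mod_cast Real.pi_ne_zero
  rw [finsum_propagating_eq_sum hΛ hk x b hK hK']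
  set c : ℕ → ℤ := fun j => (j : ℤ) - K with hc
  set e : ℕ → ℝ := fun j => alphaN Λ α (c j) - Real.pi / Λ with he
  have he' : ∀ j, alphaN Λ α (c j) + Real.pi / Λ = e (j + 1) := fun j => by
    simp only [he, hc, alphaN]; push_cast; ring
  have hg : ∀ p q, IntervalIntegrable (waveDensity k x b) volume p q := fun p q =>
    (integrable_waveDensity hk x b).intervalIntegrable
  have hsum := (hasSum_sum (s := Finset.range (2 * K)) fun j _ =>
    hasSum_integral_window hΛ (hg _ _)
      (differentiableAt_waveDensity (x := x) (b := b) hk.le (hWood (c j)))).mul_left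
    ((Real.pi : ℂ)⁻¹)
  rw [← Finset.mul_sum, show (Real.pi : ℂ)⁻¹ * (2 * Real.pi / Λ *
      ∑ j ∈ Finset.range (2 * K), waveDensity k x b (alphaN Λ α (c j))) =
      2 / Λ * ∑ j ∈ Finset.range (2 * K), waveDensity k x b (alphaN Λ α (c j)) by
    field_simp] at hsum
  refine hsum.congr_fun fun n => ?_
  have hwin : ∀ j, ∫ ξ in (alphaN Λ α (c j) - Real.pi / Λ)..(alphaN Λ α (c j) + Real.pi / Λ),
      waveDensity k x b ξ * Complex.exp (Complex.I * n * Λ * (alphaN Λ α (c j) - ξ)) =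
      Complex.exp (Complex.I * n * Λ * α) *
        ∫ ξ in e j..e (j + 1), waveDensity k (x - n * Λ) b ξ := fun j => by
    rw [he', ← intervalIntegral.integral_const_mul]
    refine integral_congr fun ξ _ => ?_
    rw [exp_mul_alphaN_sub hΛ, waveDensity_sub]
    ring
  simp_rw [hwin]
  -- For fixed `n` the adjacent windows merge into one interval containing `[-k, k]`, whose integral
  -- is `π J₀`.
  rw [← Finset.mul_sum, sum_integral_adjacent_intervals fun j _ =>
    (integrable_waveDensity hk _ b).intervalIntegrable, intervalIntegral_waveDensity hk]
  · field_simp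
  · simpa [he, hc] using hK
  · have : c (2 * K) = K := by simp only [hc]; push_cast; ring
    simpa only [he, this] using hK'

end QuasiPeriodic

/-- The lattice sum is only conditionally convergent; `SummationFilter.conditional ℤ` is the limit
of the sums over `M ≤ n ≤ N` as `M → -∞` and `N → ∞` independently. -/
theorem theorem2p3 (Λ k α : ℝ) (hΛ : 0 < Λ) (hk : 0 < k)
    (hWood : ∀ n : ℤ, |QuasiPeriodic.alphaN Λ α n| ≠ k)
    (y z : EuclideanSpace ℝ (Fin 2)) (hyz : ∀ m : ℤ, ‖y - z‖ ≠ m * Λ) :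
    HasSum
      (fun n : ℤ => Complex.I / 4 *
        (QuasiPeriodic.besselJ0 (k * ‖y - QuasiPeriodic.latticeShift Λ z n‖) : ℂ) *
          Complex.exp (Complex.I * (n : ℂ) * (Λ : ℂ) * (α : ℂ)))
      (QuasiPeriodic.F1 Λ k α y z) (SummationFilter.conditional ℤ) := by
  have h := (QuasiPeriodic.hasSum_besselJ0_mul_exp hΛ hk hWood (y 0 - z 0) (y 1 - z 1)).mul_left
    (Complex.I / 4)
  simp_rw [QuasiPeriodic.norm_sub_latticeShift, mul_assoc (Complex.I / 4)]
  rw [← mul_assoc (Complex.I / 4) (2 / (Λ : ℂ)), show Complex.I / 4 * (2 / (Λ : ℂ)) =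
    Complex.I / (2 * (Λ : ℂ)) by ring] at h
  exact h
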